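/- **Conventions.** Let $L$ be a relational language without $0$-ary relation symbols. An $L$-structure is one in which every tuple standing in a relation has pairwise distinct entries. The age of a structure is the class of finite structures that embed into it. A structure $\mathrm U$ is homogeneous if every embedding of a finite induced substructure into $\mathrm U$ extends to an automorphism of $\mathrm U$. If $\mathrm M$ and $\mathrm M'$ are structures on $B\cup C$ and $B\cup C'$ (with $B,C,C'$ pairwise disjoint) inducing the same structure on $B$, their free amalgam is the structure on $B\cup C\cup C'$ that induces $\mathrm M$ on $B\cup C$ and $\mathrm M'$ on $B\cup C'$ and in which no tuple standing in a relation contains both an element of $C$ and an element of $C'$. A class of finite structures is a free amalgamation age if it is closed under induced substructures and under free amalgams. Let $\mathrm U$ be a countable homogeneous structure with domain $U$ whose age is a free amalgamation age, and let $\mathrm G$ be its automorphism group ($\mathrm G$ need not be transitive on $U$). For $F\subseteq U$ let $\mathrm G_F$ be the pointwise stabilizer of $F$ in $\mathrm G$. A type $T=\langle F\,|\,x\rangle$ consists of a finite set $F\subseteq U$, its sockel $\iota(T)$, and an $x\in U\setminus F$; $\langle F\,|\,x\rangle$ and $\langle E\,|\,y\rangle$ are equal if $F=E$ and $g(x)=y$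 for some $g\in \mathrm G_F$. Its typeset is $\sigma(T)=\{g(x)\mid g\in \mathrm G_F\}$. A bundle is a set $\mathcal B$ of types with a common sockel $\iota(\mathcal B)$; put $\sigma(\mathcal B)=\bigcup_{T\in\mathcal B}\sigma(T)$. For $S\subseteq\sigma(\mathcal B)$ let $$\overline{\rho}(S)=\{A\subseteq\sigma(\mathcal B)\mid A \text{ finite and } g[A]\subseteq S\text{ for some } g\in \mathrm G_{\iota(\mathcal B)}\}.$$ If $\mathcal B=\{B_j\mid j<n\}$ is finite, a colouring of $S$ is a family $P=(P_{i,j};\, j<n,\ i<m_j)$, with $m_j\in\omega$, of pairwise disjoint (possibly empty) sets with $\bigcup_{i<m_j}P_{i,j}=S\cap\sigma(B_j)$ for every $j<n$; it is an $m$-colouring if $m=\max_j m_j$. Let $\mathcal E(P)$ be the set of functions $\epsilon$ on $n$ with $\epsilon(j)<m_j$ for all $j$, and put $P_\epsilon=\bigcup_{j<n}P_{\epsilon(j),j}$. The set $S$ is $\mathcal B$-age indivisible if for every colouring $P$ of $S$ there is an $\epsilon\in\mathcal E(P)$ with $\overline\rho(P_\epsilon)=\overline\rho(S)$, and the bundle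 $\mathcal B$ is $\mathcal B$-age indivisible if $\sigma(\mathcal B)$ is. A type $T$ is age indivisible if for every partition $(S_0,S_1)$ of $\sigma(T)$ there is an $i\in\{0,1\}$ such that for every finite $A\subseteq\sigma(T)$ there is an $f\in \mathrm G_{\iota(T)}$ with $f[A]\subseteq S_i$. **Theorem.** Let $\mathcal B=\{B_j\mid j<n\}$ be a finite bundle of types of $\mathrm U$. 1. If $S\subseteq\sigma(\mathcal B)$ and $\overline\rho(S)=\overline\rho(\sigma(\mathcal B))$, then for every $m\in\omega$ and every $m$-colouring $P$ of $S$ there is an $\epsilon\in\mathcal E(P)$ with $\overline\rho(P_\epsilon\cap S)=\overline\rho(\sigma(\mathcal B))$. 2. Every $S\subseteq\sigma(\mathcal B)$ with $\overline\rho(S)=\overline\rho(\sigma(\mathcal B))$ is $\mathcal B$-age indivisible. 3. The bundle $\mathcal B$ is $\mathcal B$-age indivisible. 4. Every type of $\mathrm U$ is age indivisible. -/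

import Mathlib

universe u v w

namespace FreeAmalg

open FirstOrder

section Amalgamation

variable (L : FirstOrder.Language.{u, v})

/-- Every tuple standing in a relation of `U` has pairwise distinct entries. -/
def HasInjectiveRelations (U : Type w) [L.Structure U] : Prop :=
  ∀ (n : ℕ) (R : L.Relations n) (x : Fin n → U),
    FirstOrder.Language.Structure.RelMap R x → Function.Injective x

/-- Adjacency in the Gaifman graph of `N`: two distinct elements which are entries of a common
tuple standing in a relation of `N`. -/
def GaifmanAdj {N : Type w} [L.Structure N] (a b : N) : Prop :=
  a ≠ b ∧ ∃ (n : ℕ) (R : L.Relations n) (x : Fin n → N),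
    a ∈ Set.range x ∧ b ∈ Set.range x ∧ FirstOrder.Language.Structure.RelMap R x

variable {L}

/-- `N`, with the embeddings `f` and `f'`, is the free amalgam of `M` and `M'` over their common
induced substructure `B`: the images of `M` and `M'` cover `N` and meet exactly in the image of
`B`, and no element outside the image of `M'` is adjacent to an element outside the image
of `M`. -/
structure IsFreeAmalgam {B M M' N : Type w}
    [L.Structure B] [L.Structure M] [L.Structure M'] [L.Structure N]
    (e : B ↪[L] M) (e' : B ↪[L] M') (f : M ↪[L] N) (f' : M' ↪[L] N) : Prop where
  comm : ∀ b, f (e b) = f' (e' b)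
  cover : Set.range f ∪ Set.range f' = Set.univ
  inter : Set.range f ∩ Set.range f' = Set.range fun b => f (e b)
  free : ∀ x ∈ Set.range f \ Set.range f', ∀ y ∈ Set.range f' \ Set.range f,
    ¬ GaifmanAdj L x y

/-- A class of structures is a free amalgamation age if it is closed under induced substructures
and contains the free amalgam of every amalgamation instance of its members. -/
structure IsFreeAmalgamationAge
    (K : Set (CategoryTheory.Bundled.{w} L.Structure)) : Prop where
  hereditary : FirstOrder.Language.Hereditary K
  free_amalgam : ∀ (B M M' N : CategoryTheory.Bundled.{w} L.Structure)
    (e : B ↪[L] M) (e' : B ↪[L] M') (f : M ↪[L] N) (f' : M' ↪[L] N),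
    M ∈ K → M' ∈ K → IsFreeAmalgam e e' f f' → N ∈ K

end Amalgamation

section Types

variable (L : FirstOrder.Language.{u, v}) (U : Type w) [L.Structure U]

variable {U} in
/-- The pointwise stabilizer of `F` in the automorphism group of `U`. -/
def stab (F : Set U) : Set (U ≃[L] U) := {g | ∀ a ∈ F, g a = a}

/-- A pair `⟨F | x⟩` with `F` a finite subset of `U` and `x ∈ U \ F`. -/
structure TypePair where
  sockel : Finset U
  pt : U
  pt_notMem : pt ∉ sockel

/-- `⟨F | x⟩` and `⟨E | y⟩` are identified if `F = E` and some automorphism fixing `F` pointwise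
maps `x` to `y`. -/
def TypePair.setoid : Setoid (TypePair U) where
  r p q := p.sockel = q.sockel ∧ ∃ g ∈ stab L (p.sockel : Set U), g p.pt = q.pt
  iseqv :=
    { refl := fun p => ⟨rfl, FirstOrder.Language.Equiv.refl L U, fun _ _ => rfl, rfl⟩
      symm := by
        rintro p q ⟨h, g, hg, hgp⟩
        refine ⟨h.symm, g.symm, fun a ha => ?_, ?_⟩
        · rw [← h] at ha
          conv_lhs => rw [← hg a ha]
          exact g.symm_apply_apply a
        · rw [← hgp]
          exact g.symm_apply_apply _
      trans := by
        rintro p q r ⟨h, g, hg, hgp⟩ ⟨h', k, hk, hkq⟩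
        refine ⟨h.trans h', k.comp g, fun a ha => ?_, ?_⟩
        · rw [FirstOrder.Language.Equiv.comp_apply, hg a ha]
          exact hk a (h ▸ ha)
        · rw [FirstOrder.Language.Equiv.comp_apply, hgp, hkq] }

/-- The types of `U`. -/
def UType : Type w := Quotient (TypePair.setoid L U)

variable {L U}

/-- The set of `y ∈ U \ F` to which an automorphism fixing `F` pointwise maps `x`. -/
def TypePair.typeset (L : FirstOrder.Language.{u, v}) [L.Structure U] (p : TypePair U) : Set U :=
  {y | y ∉ p.sockel ∧ ∃ g ∈ stab L (p.sockel : Set U), g p.pt = y}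

/-- The sockel of a type. -/
def UType.sockel (T : UType L U) : Finset U :=
  Quotient.lift (s := TypePair.setoid L U) TypePair.sockel (fun _ _ h => h.1) T

/-- The typeset of a type. -/
def UType.typeset (T : UType L U) : Set U :=
  Quotient.lift (s := TypePair.setoid L U) (TypePair.typeset L) (by
    have key : ∀ p q : TypePair U, TypePair.setoid L U p q → TypePair.typeset L p ⊆ TypePair.typeset L q := by
      intro p q hpq y hy
      obtain ⟨h, k, hk, hkq⟩ := (TypePair.setoid L U).symm hpq
      obtain ⟨hy, g, hg, hgy⟩ := hy
      refine ⟨h ▸ hy, g.comp k, fun a ha => ?_, ?_⟩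
      · rw [FirstOrder.Language.Equiv.comp_apply, hk a ha]
        exact hg a (h ▸ ha)
      · rw [FirstOrder.Language.Equiv.comp_apply, hkq, hgy]
    exact fun p q h => (key p q h).antisymm (key q p ((TypePair.setoid L U).symm h))) T

/-- A type is age indivisible if for every partition of its typeset into two parts, one of the
parts receives every finite subset of the typeset under an automorphism fixing the sockel
pointwise. -/
def UType.IsAgeIndivisible (T : UType L U) : Prop :=
  ∀ S : Fin 2 → Set U, Disjoint (S 0) (S 1) → S 0 ∪ S 1 = T.typeset →
    ∃ i, ∀ A : Finset U, (A : Set U) ⊆ T.typeset →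
      ∃ f ∈ stab L (T.sockel : Set U), f '' (A : Set U) ⊆ S i

end Types

section Bundles

variable {L : FirstOrder.Language.{u, v}} {U : Type w} [L.Structure U]

/-- A bundle is a set of types all of which have the same sockel. -/
def IsBundle (𝓑 : Set (UType L U)) : Prop :=
  ∀ S ∈ 𝓑, ∀ T ∈ 𝓑, S.sockel = T.sockel

/-- The common sockel of the types of a bundle (empty for the empty bundle). -/
def bundleSockel (𝓑 : Set (UType L U)) : Set U := ⋃ T ∈ 𝓑, (T.sockel : Set U)

/-- The union of the typesets of the types of a bundle. -/
def bundleTypeset (𝓑 : Set (UType L U)) : Set U := ⋃ T ∈ 𝓑, T.typeset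

/-- The finite subsets of the typeset union of `𝓑` which can be mapped into `S` by an automorphism
fixing the sockel of `𝓑` pointwise. -/
def bundleAge (𝓑 : Set (UType L U)) (S : Set U) : Set (Finset U) :=
  {A | (A : Set U) ⊆ bundleTypeset 𝓑 ∧
    ∃ g ∈ stab L (bundleSockel 𝓑), g '' (A : Set U) ⊆ S}

/-- `S` is `𝓑`-age complete. -/
def IsAgeComplete (𝓑 : Set (UType L U)) (S : Set U) : Prop :=
  bundleAge 𝓑 S = bundleAge 𝓑 (bundleTypeset 𝓑)

/-- A colouring of `S`: for every type `T` of the bundle a partition of `S ∩ σ(T)` into finitely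
many, possibly empty, parts; all parts are pairwise disjoint. -/
structure Colouring (𝓑 : Set (UType L U)) (S : Set U) where
  numColours : 𝓑 → ℕ
  part : (T : 𝓑) → Fin (numColours T) → Set U
  disjoint : ∀ (T T' : 𝓑) (i : Fin (numColours T)) (i' : Fin (numColours T')),
    (⟨T, i⟩ : (T : 𝓑) × Fin (numColours T)) ≠ ⟨T', i'⟩ → Disjoint (part T i) (part T' i')
  cover : ∀ T : 𝓑, ⋃ i, part T i = S ∩ T.1.typeset

namespace Colouring

variable {𝓑 : Set (UType L U)} {S : Set U}

/-- `m` is the maximum of the numbers of colours (for a finite bundle; `0` if it is empty). -/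
def IsMColouring (P : Colouring 𝓑 S) (m : ℕ) : Prop := ⨆ T, P.numColours T = m

/-- The functions choosing one colour for every type of the bundle. -/
def Choice (P : Colouring 𝓑 S) : Type w := (T : 𝓑) → Fin (P.numColours T)

/-- The union of the chosen parts. -/
def select (P : Colouring 𝓑 S) (ε : P.Choice) : Set U := ⋃ T : 𝓑, P.part T (ε T)

end Colouring

/-- `S` is `𝓑`-age indivisible. -/
def IsBundleAgeIndivisible (𝓑 : Set (UType L U)) (S : Set U) : Prop :=
  ∀ P : Colouring 𝓑 S, ∃ ε : P.Choice, bundleAge 𝓑 (P.select ε) = bundleAge 𝓑 S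

end Bundles

end FreeAmalg

/-! The proof is a vertex version of the Nešetřil–Rödl partite construction, carried out inside `U`
over the sockel `F`. Fix an orbit `X` of the pointwise stabilizer of `F`. A partite set is a finite
set with some of its points of `X` sorted into parts, such that a related tuple has at most one
point in each part. On `F` together with one part, every relation is then determined by the type of
a single point over `F`, which is constant on `X`. So by homogeneity any injection between two parts
is induced by an automorphism fixing `F` (`IsPartite.exists_map_part`). Free amalgamation creates no
tuple across the two sides, so it preserves partiteness (`IsPartite.amalgam`). By pigeonhole, a
large enough part contains a monochromatic image of a given part. Attaching a copy of the partite
set along every injection of its part into the large one makes that part monochromatic, and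
iterating treats all parts. Starting from copies of `A`, one for each injective assignment of the
points of `A ∩ X` to `N` parts, a second pigeonhole on the colours of the parts finds a copy of `A`
with `A ∩ X` monochromatic (`exists_monochromatic_copy`). Iteration over the types of the bundle
handles finitely many orbits. If every choice of parts failed to be age complete, the union of the
finitely many witnesses would contradict this Ramsey property, after pulling the colouring back
along a copy inside `S`. -/

namespace FreeAmalg

open FirstOrder FirstOrder.Language

/-! ### Realizing free amalgams inside `U`. -/

section Amalgamation

variable {L : FirstOrder.Language.{u, v}} {U : Type w} [L.Structure U]

/-- In a relational language every set carries an induced substructure. -/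
def subOf [L.IsRelational] (s : Set U) : L.Substructure U where
  carrier := s
  fun_mem f := isEmptyElim f

theorem subOf_fg [L.IsRelational] (s : Finset U) : (subOf (L := L) (s : Set U)).FG :=
  ⟨s, le_antisymm (Substructure.closure_le.2 fun _ h => h) Substructure.subset_closure⟩

/-- In an ultrahomogeneous relational structure a finite partial isomorphism extends to an
automorphism. -/
theorem exists_equiv_extending [L.IsRelational] (hhom : L.IsUltrahomogeneous U) (W : Finset U)
    (φ : U → U) (hφ : Set.InjOn φ W)
    (hrel : ∀ (n : ℕ) (R : L.Relations n) (x : Fin n → U), (∀ p, x p ∈ W) →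
      (Structure.RelMap R (φ ∘ x) ↔ Structure.RelMap R x)) :
    ∃ g : U ≃[L] U, ∀ w ∈ W, g w = φ w := by
  let f : subOf (L := L) (W : Set U) ↪[L] U :=
    { toFun := fun w => φ w
      inj' := fun a b h => Subtype.ext (hφ a.2 b.2 h)
      map_fun' := fun f => isEmptyElim f
      map_rel' := fun R x => hrel _ R (fun p => x p) fun p => (x p).2 }
  obtain ⟨g, hg⟩ := hhom _ (subOf_fg W) f
  exact ⟨g, fun w hw => (DFunLike.congr_fun hg ⟨w, hw⟩).symm⟩

section FreeSum

variable [L.IsRelational] (B M M' : Finset U)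

/-- The underlying set of the free amalgam of `M` and `M'` over `B`. -/
def FreeSum : Type w := {x // x ∈ M'} ⊕ {x // x ∈ M ∧ x ∉ B}

variable {B M M'}

open Classical in
/-- The inclusion of `M` into the free amalgam. -/
noncomputable def FreeSum.left (hB : B ⊆ M') (m : {x // x ∈ M}) : FreeSum B M M' :=
  if h : m.1 ∈ B then Sum.inl ⟨m, hB h⟩ else Sum.inr ⟨m, m.2, h⟩

theorem FreeSum.left_of_mem (hB : B ⊆ M') (m : {x // x ∈ M}) (h : m.1 ∈ B) :
    FreeSum.left hB m = (Sum.inl ⟨m, hB h⟩ : FreeSum B M M') := dif_pos h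

theorem FreeSum.left_of_notMem (hB : B ⊆ M') (m : {x // x ∈ M}) (h : m.1 ∉ B) :
    FreeSum.left hB m = (Sum.inr ⟨m, m.2, h⟩ : FreeSum B M M') := dif_neg h

theorem FreeSum.left_eq_inl (hB : B ⊆ M') {m : {x // x ∈ M}} {m' : {x // x ∈ M'}}
    (h : FreeSum.left hB m = (Sum.inl m' : FreeSum B M M')) : m.1 ∈ B ∧ m.1 = m'.1 := by
  by_cases hm : m.1 ∈ B
  · rw [left_of_mem hB m hm] at h
    exact ⟨hm, congrArg Subtype.val (Sum.inl.inj h)⟩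
  · rw [left_of_notMem hB m hm] at h
    exact absurd h Sum.inr_ne_inl

theorem FreeSum.left_injective (hB : B ⊆ M') :
    Function.Injective (FreeSum.left (M := M) hB) := by
  intro a b h
  by_cases hb : b.1 ∈ B
  · rw [left_of_mem hB b hb] at h
    exact Subtype.ext (left_eq_inl hB h).2
  · by_cases ha : a.1 ∈ B
    · rw [left_of_mem hB a ha] at h
      exact (Subtype.ext (left_eq_inl hB h.symm).2).symm
    · rw [left_of_notMem hB b hb, left_of_notMem hB a ha] at h
      exact Subtype.ext (congrArg Subtype.val (Sum.inr.inj h) :)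

/-- The structure of the free amalgam. -/
noncomputable abbrev FreeSum.instRel (hB : B ⊆ M') : L.Structure (FreeSum B M M') where
  funMap f := isEmptyElim f
  RelMap {n} R y :=
    (∃ x : Fin n → {x // x ∈ M'}, (∀ p, y p = Sum.inl (x p)) ∧
      Structure.RelMap R fun p => (x p).1) ∨
    ∃ x : Fin n → {x // x ∈ M}, (∀ p, y p = FreeSum.left hB (x p)) ∧
      Structure.RelMap R fun p => (x p).1

end FreeSum

/-- Inside an ultrahomogeneous structure with a free amalgamation age, a finite set `M` has a copy
over `B` which is in free position to `M'` over `B`. -/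
theorem exists_free_copy [L.IsRelational] (hhom : L.IsUltrahomogeneous U)
    (hfree : IsFreeAmalgamationAge (L.age U)) (B M M' : Finset U) (hBM : B ⊆ M) (hB : B ⊆ M') :
    ∃ g : U ≃[L] U, (∀ b ∈ B, g b = b) ∧ (∀ m ∈ M, m ∉ B → g m ∉ M') ∧
      ∀ (n : ℕ) (R : L.Relations n) (x : Fin n → U), Structure.RelMap R x →
        (∀ p, x p ∈ M' ∨ ∃ m ∈ M, g m = x p) →
        (∀ p, x p ∈ M') ∨ ∀ p, ∃ m ∈ M, g m = x p := by
  let _ : L.Structure (FreeSum B M M') := FreeSum.instRel hB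
  let f' : subOf (L := L) (M' : Set U) ↪[L] FreeSum B M M' :=
    { toFun := Sum.inl
      inj' := Sum.inl_injective
      map_fun' := fun f => isEmptyElim f
      map_rel' := by
        intro n R x
        constructor
        · rintro (⟨y, hy, hR⟩ | ⟨y, hy, hR⟩)
          · have : x = y := funext fun p => Sum.inl.inj (hy p)
            rw [this]; exact hR
          -- A tuple arising from both sides lies in `B`, where both inclusions keep the underlying
          -- point of `U`; the two clauses of the relation therefore agree.
          · have : (fun p => (y p).1) = fun p => (x p).1 :=
              funext fun p => (FreeSum.left_eq_inl hB (hy p).symm).2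
            rw [this] at hR; exact hR
        · exact fun hR => Or.inl ⟨x, fun _ => rfl, hR⟩ }
  let f : subOf (L := L) (M : Set U) ↪[L] FreeSum B M M' :=
    { toFun := FreeSum.left hB
      inj' := FreeSum.left_injective hB
      map_fun' := fun f => isEmptyElim f
      map_rel' := by
        intro n R x
        constructor
        · rintro (⟨y, hy, hR⟩ | ⟨y, hy, hR⟩)
          · have : (fun p => (x p).1) = fun p => (y p).1 :=
              funext fun p => (FreeSum.left_eq_inl hB (hy p)).2
            rw [← this] at hR; exact hR
          · have : x = y := funext fun p => FreeSum.left_injective hB (hy p)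
            rw [this]; exact hR
        · exact fun hR => Or.inr ⟨x, fun _ => rfl, hR⟩ }
  have hBM₁ : subOf (L := L) (B : Set U) ≤ subOf (M : Set U) := fun _ h => hBM h
  have hBM₂ : subOf (L := L) (B : Set U) ≤ subOf (M' : Set U) := fun _ h => hB h
  have hmem : ∀ s : Finset U,
      (⟨subOf (L := L) (s : Set U), inferInstance⟩ : CategoryTheory.Bundled.{w} L.Structure) ∈
        L.age U := fun s =>
    ⟨(Substructure.fg_iff_structure_fg _).1 (subOf_fg s), ⟨Substructure.subtype _⟩⟩
  have hamalg : IsFreeAmalgam (Substructure.inclusion hBM₁) (Substructure.inclusion hBM₂) f f' := by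
    have hcomm : ∀ b, f (Substructure.inclusion hBM₁ b) = f' (Substructure.inclusion hBM₂ b) :=
      fun b => FreeSum.left_of_mem (M := M) hB ⟨b.1, hBM b.2⟩ b.2
    refine ⟨hcomm, ?_, ?_, ?_⟩
    · refine Set.eq_univ_of_forall ?_
      rintro (a | a)
      · exact Or.inr ⟨a, rfl⟩
      · exact Or.inl ⟨⟨a.1, a.2.1⟩, FreeSum.left_of_notMem hB _ a.2.2⟩
    · ext y
      constructor
      · rintro ⟨⟨m, rfl⟩, ⟨m', hm'⟩⟩
        refine ⟨⟨m.1, (FreeSum.left_eq_inl hB hm'.symm).1⟩, rfl⟩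
      · rintro ⟨b, rfl⟩
        exact ⟨⟨_, rfl⟩, ⟨_, (hcomm b).symm⟩⟩
    · rintro x ⟨-, hx⟩ y ⟨-, hy⟩ ⟨-, n, R, z, ⟨p, rfl⟩, ⟨q, rfl⟩, ⟨t, ht, -⟩ | ⟨t, ht, -⟩⟩
      · exact hx ⟨t p, (ht p).symm⟩
      · exact hy ⟨t q, (ht q).symm⟩
  obtain ⟨-, ⟨h⟩⟩ := hfree.free_amalgam ⟨_, inferInstance⟩ ⟨_, inferInstance⟩ ⟨_, inferInstance⟩
    ⟨FreeSum B M M', inferInstance⟩ _ _ f f' (hmem M) (hmem M') hamalg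
  -- The embedding `h` of the amalgam moves both sides. Extending its restrictions to automorphisms
  -- `k` and `k₂`, the composite `k.symm.comp k₂` puts `M'` back in place and carries `M` to the
  -- free copy.
  obtain ⟨k, hk⟩ := hhom _ (subOf_fg M') (h.comp f')
  obtain ⟨k₂, hk₂⟩ := hhom _ (subOf_fg M) (h.comp f)
  replace hk : ∀ m (hm : m ∈ M'), h (Sum.inl ⟨m, hm⟩) = k m := fun m hm =>
    DFunLike.congr_fun hk ⟨m, hm⟩
  replace hk₂ : ∀ m (hm : m ∈ M), h (FreeSum.left hB ⟨m, hm⟩) = k₂ m := fun m hm =>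
    DFunLike.congr_fun hk₂ ⟨m, hm⟩
  have hg : ∀ m, k (k.symm.comp k₂ m) = k₂ m := fun m => k.apply_symm_apply _
  refine ⟨k.symm.comp k₂, fun b hb => k.injective ?_, fun m hm hmB hmM' => ?_, ?_⟩
  · rw [hg, ← hk b (hB hb), ← hk₂ b (hBM hb), FreeSum.left_of_mem hB _ hb]
  · have := hk _ hmM'
    rw [hg, ← hk₂ m hm, FreeSum.left_of_notMem hB _ hmB] at this
    exact Sum.inl_ne_inr (h.injective this)
  · intro n R x hR hx
    have : ∀ p, ∃ y, h y = k (x p) := by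
      intro p
      obtain hp | ⟨m, hm, hp⟩ := hx p
      · exact ⟨_, hk _ hp⟩
      · exact ⟨_, by rw [← hp, hg]; exact hk₂ m hm⟩
    choose y hy using this
    have hRy : Structure.RelMap R y := by
      rw [← h.map_rel, ← k.symm.map_rel]
      convert hR using 1
      funext p
      simp [hy]
    obtain ⟨z, hz, -⟩ | ⟨z, hz, -⟩ := hRy
    · refine Or.inl fun p => ?_
      have := hk _ (z p).2
      rw [← hz p, hy p] at this
      rw [k.injective this]
      exact (z p).2
    · refine Or.inr fun p => ⟨z p, (z p).2, k.injective ?_⟩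
      rw [hg, ← hk₂ _ (z p).2, ← hy p, hz p]

end Amalgamation

/-! ### Partite sets over `F` and the partite construction. -/

section Partite

variable {L : FirstOrder.Language.{u, v}} {U : Type w} [L.Structure U]

theorem stab_comp {F : Set U} {g h : U ≃[L] U} (hg : g ∈ stab L F) (hh : h ∈ stab L F) :
    g.comp h ∈ stab L F := fun a ha => by
  rw [FirstOrder.Language.Equiv.comp_apply, hh a ha, hg a ha]

theorem refl_mem_stab {F : Set U} : FirstOrder.Language.Equiv.refl L U ∈ stab L F :=
  fun _ _ => rfl

variable (L) in
/-- `X` is an orbit of the pointwise stabilizer of `F`, disjoint from `F` (or `X` is empty). -/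
structure IsOrbitOver (F : Finset U) (X : Set U) : Prop where
  notMem : ∀ x ∈ X, x ∉ F
  map_mem : ∀ g ∈ stab L (F : Set U), ∀ x ∈ X, g x ∈ X
  trans : ∀ x ∈ X, ∀ y ∈ X, ∃ g ∈ stab L (F : Set U), g x = y

variable (L) in
/-- `D` is a finite set containing `F`, some elements of which are distributed into parts
contained in `X`, indexed by `ℕ`, such that every tuple of `D` standing in a relation meets
every part in at most one point. -/
structure IsPartite (F : Finset U) (X : Set U) (D : Finset U) (π : U → Option ℕ) : Prop where
  subset : F ⊆ D
  none_of_mem : ∀ a ∈ F, π a = none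
  mem_of_some : ∀ a ∈ D, ∀ i, π a = some i → a ∈ X
  eq_of_rel : ∀ (n : ℕ) (R : L.Relations n) (x : Fin n → U), Structure.RelMap R x →
    (∀ p, x p ∈ D) → ∀ (p q : Fin n) (i : ℕ), π (x p) = some i → π (x q) = some i → x p = x q

variable {F : Finset U} {X : Set U}

theorem isPartite_base : IsPartite L F X F fun _ => none :=
  ⟨subset_rfl, fun _ _ => rfl, fun _ _ _ h => (Option.some_ne_none _ h.symm).elim,
    fun _ _ _ _ _ _ _ _ h => (Option.some_ne_none _ h.symm).elim⟩

open Classical in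
/-- Two partite sets can be amalgamated freely over a common part. -/
theorem IsPartite.amalgam [L.IsRelational] (hhom : L.IsUltrahomogeneous U)
    (hfree : IsFreeAmalgamationAge (L.age U)) (hX : IsOrbitOver L F X)
    {D D' : Finset U} {π π' : U → Option ℕ} (hD' : IsPartite L F X D' π')
    (hD : IsPartite L F X D π) {W : Finset U} (hFW : F ⊆ W) (hWD : W ⊆ D) {g : U ≃[L] U}
    (hg : g ∈ stab L (F : Set U)) (hgW : ∀ w ∈ W, g w ∈ D' ∧ π' (g w) = π w) :
    ∃ (D'' : Finset U) (π'' : U → Option ℕ) (g' : U ≃[L] U), IsPartite L F X D'' π'' ∧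
      D' ⊆ D'' ∧ (∀ a ∈ D', π'' a = π' a) ∧ g' ∈ stab L (F : Set U) ∧
      (∀ w ∈ W, g' w = g w) ∧ (∀ d ∈ D, g' d ∈ D'' ∧ π'' (g' d) = π d) ∧
      ∀ d ∈ D, d ∉ W → g' d ∉ D' := by
  -- The copy `g[D]` may overlap `D'` outside `g[W]`; it is moved, with `g[W]` fixed, into free
  -- position.
  obtain ⟨h, hfix, hdisj, hrel⟩ := exists_free_copy hhom hfree (W.image g) (D.image g) D'
    (Finset.image_subset_image hWD) (Finset.image_subset_iff.2 fun w hw => (hgW w hw).1)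
  have hg'W : ∀ w ∈ W, h.comp g w = g w := fun w hw => hfix _ (Finset.mem_image_of_mem _ hw)
  have hg' : h.comp g ∈ stab L (F : Set U) := fun a ha => by
    rw [hg'W a (hFW ha), hg a ha]
  have hnew : ∀ d ∈ D, d ∉ W → h.comp g d ∉ D' := fun d hd hdW =>
    hdisj _ (Finset.mem_image_of_mem _ hd) fun hmem => by
      obtain ⟨w, hw, hwd⟩ := Finset.mem_image.1 hmem
      exact hdW (g.injective hwd ▸ hw)
  generalize hk : h.comp g = k at *
  let π'' : U → Option ℕ := fun a => if a ∈ D' then π' a else π (k.symm a)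
  have h₁ : ∀ a ∈ D', π'' a = π' a := fun a ha => if_pos ha
  have h₂ : ∀ d ∈ D, π'' (k d) = π d := by
    intro d hd
    by_cases hdD : k d ∈ D'
    · have hdW : d ∈ W := by
        by_contra hdW
        exact hnew d hd hdW hdD
      rw [h₁ _ hdD, hg'W d hdW, (hgW d hdW).2]
    · simp [π'', hdD]
  refine ⟨D' ∪ D.image k, π'', k, ⟨?_, ?_, ?_, ?_⟩, Finset.subset_union_left, h₁, hg', hg'W,
    fun d hd => ⟨Finset.mem_union_right _ (Finset.mem_image_of_mem _ hd), h₂ d hd⟩, hnew⟩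
  · exact hD'.subset.trans Finset.subset_union_left
  · intro a ha
    rw [h₁ a (hD'.subset ha), hD'.none_of_mem a ha]
  · intro a ha i hi
    obtain ha | ha := Finset.mem_union.1 ha
    · exact hD'.mem_of_some a ha i (h₁ a ha ▸ hi)
    · obtain ⟨d, hd, rfl⟩ := Finset.mem_image.1 ha
      exact hX.map_mem _ hg' _ (hD.mem_of_some d hd i (h₂ d hd ▸ hi))
  · intro n R x hR hx p q i hp hq
    -- By freeness the tuple lies on one side, so partiteness is inherited from that side.
    have hx' : (∀ p, x p ∈ D') ∨ ∀ p, ∃ d ∈ D, k d = x p := by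
      have := hrel n R x hR fun p => by
        refine (Finset.mem_union.1 (hx p)).imp_right fun hp => ?_
        obtain ⟨d, hd, hdp⟩ := Finset.mem_image.1 hp
        exact ⟨g d, Finset.mem_image_of_mem _ hd, by rw [← hdp, ← hk]; rfl⟩
      refine this.imp_right fun H p => ?_
      obtain ⟨m, hm, hmp⟩ := H p
      obtain ⟨d, hd, rfl⟩ := Finset.mem_image.1 hm
      exact ⟨d, hd, by rw [← hmp, ← hk]; rfl⟩
    obtain H | H := hx'
    · rw [h₁ _ (H p)] at hp
      rw [h₁ _ (H q)] at hq
      exact hD'.eq_of_rel n R x hR H p q i hp hq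
    · choose y hyD hy using H
      have hRy : Structure.RelMap R y := by
        rw [← k.map_rel]
        rwa [show k ∘ y = x from funext hy]
      rw [← hy p, h₂ _ (hyD p)] at hp
      rw [← hy q, h₂ _ (hyD q)] at hq
      rw [← hy p, ← hy q, hD.eq_of_rel n R y hRy hyD p q i hp hq]

/-- Copies are attached one at a time; later amalgamations change neither the earlier points nor
their indices. Both the sorting `π k` and the gluing map `g k` may vary with `k`: varying `g`
attaches one set along many injections of a part, varying `π` gives copies of one set sorted in many
ways. -/
theorem IsPartite.amalgam_family [L.IsRelational] (hhom : L.IsUltrahomogeneous U)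
    (hfree : IsFreeAmalgamationAge (L.age U)) (hX : IsOrbitOver L F X) {κ : Type*}
    {D D' : Finset U} {π : κ → U → Option ℕ} {π' : U → Option ℕ} (hD' : IsPartite L F X D' π')
    {W : Finset U} (hFW : F ⊆ W) (hWD : W ⊆ D) {g : κ → U ≃[L] U}
    (hD : ∀ k, IsPartite L F X D (π k))
    (hg : ∀ k, g k ∈ stab L (F : Set U)) (hgW : ∀ k, ∀ w ∈ W, g k w ∈ D' ∧ π' (g k w) = π k w)
    (s : Finset κ) :
    ∃ (D'' : Finset U) (π'' : U → Option ℕ), IsPartite L F X D'' π'' ∧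
      D' ⊆ D'' ∧ (∀ a ∈ D', π'' a = π' a) ∧ ∀ k ∈ s, ∃ g' ∈ stab L (F : Set U),
      (∀ w ∈ W, g' w = g k w) ∧ ∀ d ∈ D, g' d ∈ D'' ∧ π'' (g' d) = π k d := by
  classical
  induction s using Finset.induction_on with
  | empty => exact ⟨D', π', hD', subset_rfl, fun _ _ => rfl, by simp⟩
  | insert k s _ ih =>
    obtain ⟨D₁, π₁, hD₁, hsub, hπ₁, hs⟩ := ih
    obtain ⟨D₂, π₂, g', hD₂, hsub₂, hπ₂, hg', hg'W, hg'D, -⟩ :=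
      hD₁.amalgam hhom hfree hX (hD k) hFW hWD (hg k) fun w hw =>
        ⟨hsub (hgW k w hw).1, by rw [hπ₁ _ (hgW k w hw).1, (hgW k w hw).2]⟩
    refine ⟨D₂, π₂, hD₂, hsub.trans hsub₂, fun a ha => by rw [hπ₂ _ (hsub ha), hπ₁ a ha], ?_⟩
    intro j hj
    obtain rfl | hj := Finset.mem_insert.1 hj
    · exact ⟨g', hg', hg'W, hg'D⟩
    · obtain ⟨f, hf, hfW, hfD⟩ := hs j hj
      exact ⟨f, hf, hfW, fun d hd => ⟨hsub₂ (hfD d hd).1, by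
        rw [hπ₂ _ (hfD d hd).1, (hfD d hd).2]⟩⟩

/-- There are partite sets with arbitrarily large parts. -/
theorem exists_isPartite_card [L.IsRelational] (hhom : L.IsUltrahomogeneous U)
    (hfree : IsFreeAmalgamationAge (L.age U)) (hX : IsOrbitOver L F X) {x : U} (hx : x ∈ X)
    (i m : ℕ) : ∃ (D : Finset U) (π : U → Option ℕ), IsPartite L F X D π ∧
      m ≤ (D.filter fun a => π a = some i).card := by
  classical
  induction m with
  | zero => exact ⟨F, _, isPartite_base, Nat.zero_le _⟩
  | succ m ih =>
    obtain ⟨D, π, hD, hm⟩ := ih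
    have hne : ∀ a ∈ F, a ≠ x := fun a ha h => hX.notMem x hx (h ▸ ha)
    have hpt : IsPartite L F X (insert x F) fun a => if a = x then some i else none :=
      { subset := Finset.subset_insert _ _
        none_of_mem := fun a ha => if_neg (hne a ha)
        mem_of_some := fun a _ j hj => by
          by_cases h : a = x
          · rwa [h]
          · simp [h] at hj
        eq_of_rel := fun n R y _ _ p q j hp hq => by
          by_cases h : y p = x
          · by_cases h' : y q = x
            · rw [h, h']
            · simp [h'] at hq
          · simp [h] at hp }
    -- Amalgamating a single point freely over `F` adds a genuinely new point to part `i`.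
    obtain ⟨D', π', g, hD', hsub, hπ, -, -, hgD, hnew⟩ :=
      hD.amalgam hhom hfree hX hpt subset_rfl (Finset.subset_insert _ _) refl_mem_stab
        fun w hw => ⟨hD.subset hw, by
          rw [if_neg (hne w hw)]; exact hD.none_of_mem w hw⟩
    refine ⟨D', π', hD', ?_⟩
    have hgx := hgD x (Finset.mem_insert_self _ _)
    have hgx' := hnew x (Finset.mem_insert_self _ _) (hX.notMem x hx)
    rw [if_pos rfl] at hgx
    have hle : insert (g x) (D.filter fun a => π a = some i) ⊆
        D'.filter fun a => π' a = some i := by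
      intro a ha
      obtain rfl | ha := Finset.mem_insert.1 ha
      · exact Finset.mem_filter.2 hgx
      · obtain ⟨ha, hi⟩ := Finset.mem_filter.1 ha
        exact Finset.mem_filter.2 ⟨hsub ha, by rw [hπ a ha, hi]⟩
    refine le_trans ?_ (Finset.card_le_card hle)
    rw [Finset.card_insert_of_notMem fun h => hgx' (Finset.mem_filter.1 h).1]
    omega

open Classical in
/-- An injection between parts with the same index is induced by an automorphism. -/
theorem IsPartite.exists_map_part [L.IsRelational] (hhom : L.IsUltrahomogeneous U)
    (hX : IsOrbitOver L F X) {D D' : Finset U} {π π' : U → Option ℕ}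
    (hD : IsPartite L F X D π) (hD' : IsPartite L F X D' π') (i : ℕ)
    (k : {a // a ∈ D.filter fun a => π a = some i} ↪ {a // a ∈ D'.filter fun a => π' a = some i}) :
    ∃ g ∈ stab L (F : Set U), ∀ a, g a.1 = (k a).1 := by
  have hk := fun a => Finset.mem_filter.1 (k a).2
  have hkX : ∀ a, (k a).1 ∈ X := fun a => hD'.mem_of_some _ (hk a).1 i (hk a).2
  have hDX : ∀ a ∈ D.filter fun a => π a = some i, a ∈ X := fun a ha =>
    hD.mem_of_some _ (Finset.mem_filter.1 ha).1 i (Finset.mem_filter.1 ha).2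
  let φ : U → U := fun a => if h : a ∈ D.filter fun a => π a = some i then k ⟨a, h⟩ else a
  have hφk : ∀ a (h : a ∈ D.filter fun a => π a = some i), φ a = k ⟨a, h⟩ := fun a h => dif_pos h
  have hφF : ∀ a ∈ F, φ a = a := fun a ha => dif_neg fun h => hX.notMem a (hDX a h) ha
  have hφD' : ∀ a ∈ F ∪ D.filter fun a => π a = some i, φ a ∈ D' := by
    intro a ha
    obtain ha | ha := Finset.mem_union.1 ha
    · rw [hφF a ha]; exact hD'.subset ha
    · rw [hφk a ha]; exact (hk _).1
  have hinj : Set.InjOn φ (F ∪ D.filter fun a => π a = some i : Finset U) := by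
    intro a ha b hb hab
    obtain ha | ha := Finset.mem_union.1 ha <;> obtain hb | hb := Finset.mem_union.1 hb
    · rwa [hφF a ha, hφF b hb] at hab
    · rw [hφF a ha, hφk b hb] at hab
      exact absurd ha (hab ▸ hX.notMem _ (hkX _))
    · rw [hφF b hb, hφk a ha] at hab
      exact absurd hb (hab ▸ hX.notMem _ (hkX _))
    · rw [hφk a ha, hφk b hb] at hab
      exact congrArg Subtype.val (k.injective (Subtype.ext hab))
  -- On a tuple whose entries outside `F` are all one point, `φ` agrees with a stabilizer element
  -- moving that point within the orbit `X`, so relations are preserved.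
  have key : ∀ {n : ℕ} (x : Fin n → U) (p : Fin n) (_ : ∀ q, x q ∈ F ∨ x q = x p)
      (_ : x p ∈ D.filter fun a => π a = some i) (R : L.Relations n),
      Structure.RelMap R (φ ∘ x) ↔ Structure.RelMap R x := by
    intro n x p hx hp R
    obtain ⟨g, hg, hgp⟩ := hX.trans _ (hDX _ hp) _ (hkX ⟨_, hp⟩)
    have : φ ∘ x = g ∘ x := by
      funext q
      obtain hq | hq := hx q
      · exact (hφF _ hq).trans (hg _ hq).symm
      · simp only [Function.comp_apply, hq]
        rw [hφk _ hp, hgp]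
    rw [this, g.map_rel]
  obtain ⟨g, hg⟩ := exists_equiv_extending hhom (F ∪ D.filter fun a => π a = some i) φ hinj (by
    intro n R x hx
    by_cases hall : ∀ p, x p ∈ F
    · rw [show φ ∘ x = x from funext fun p => hφF _ (hall p)]
    · push Not at hall
      obtain ⟨p, hp⟩ := hall
      have hp' := (Finset.mem_union.1 (hx p)).resolve_left hp
      have hxD : ∀ q, x q ∈ D := fun q => (Finset.mem_union.1 (hx q)).elim
        (fun h => hD.subset h) fun h => (Finset.mem_filter.1 h).1
      constructor
      -- Partiteness of `D'` and injectivity of `φ` reduce this direction to `key`; the converse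
      -- uses partiteness of `D`.
      · intro hR
        refine (key x p (fun q => ?_) hp' R).1 hR
        refine (Finset.mem_union.1 (hx q)).imp_right fun hq => hinj (hx q) (hx p) ?_
        refine hD'.eq_of_rel n R _ hR (fun q => hφD' _ (hx q)) q p i ?_ ?_
        · rw [Function.comp_apply, hφk _ hq]; exact (hk _).2
        · rw [Function.comp_apply, hφk _ hp']; exact (hk _).2
      · intro hR
        refine (key x p (fun q => ?_) hp' R).2 hR
        refine (Finset.mem_union.1 (hx q)).imp_right fun hq => ?_
        exact hD.eq_of_rel n R _ hR hxD q p i (Finset.mem_filter.1 hq).2 (Finset.mem_filter.1 hp').2)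
  refine ⟨g, fun a ha => ?_, fun a => ?_⟩
  · rw [hg a (Finset.mem_union_left _ ha), hφF a ha]
  · rw [hg a (Finset.mem_union_right _ a.2), hφk a a.2]

/-- Pigeonhole. The strict inequality guarantees a colour even when `α` is empty. -/
theorem exists_embedding_fiber {α β : Type*} [Fintype α] [Fintype β] {r : ℕ} (c : β → Fin r)
    (h : r * Fintype.card α < Fintype.card β) :
    ∃ (y : Fin r) (k : α ↪ β), ∀ a, c (k a) = y := by
  classical
  obtain ⟨y, hy⟩ := Fintype.exists_lt_card_fiber_of_mul_lt_card (f := c) (n := Fintype.card α)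
    (by simpa using h)
  obtain ⟨k⟩ : Nonempty (α ↪ {b // b ∈ Finset.univ.filter fun b => c b = y}) :=
    Function.Embedding.nonempty_of_card_le (by
      rw [Fintype.card_coe]; exact hy.le)
  exact ⟨y, k.trans (Function.Embedding.subtype _), fun a => (Finset.mem_filter.1 (k a).2).2⟩

/-- One part of a partite set can be made monochromatic. -/
theorem IsPartite.exists_monochromatic_part [L.IsRelational] (hhom : L.IsUltrahomogeneous U)
    (hfree : IsFreeAmalgamationAge (L.age U)) (hX : IsOrbitOver L F X)
    {D : Finset U} {π : U → Option ℕ} (hD : IsPartite L F X D π) (r i : ℕ) [NeZero r] :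
    ∃ (D' : Finset U) (π' : U → Option ℕ), IsPartite L F X D' π' ∧
      ∀ c : U → Fin r, ∃ g ∈ stab L (F : Set U), (∀ d ∈ D, g d ∈ D' ∧ π' (g d) = π d) ∧
        ∃ y, ∀ d ∈ D, π d = some i → c (g d) = y := by
  classical
  -- An empty part is monochromatic in any colour; a nonempty one supplies the point of `X` needed
  -- to build large parts.
  by_cases hne : ∃ d ∈ D, π d = some i
  swap
  · push Not at hne
    exact ⟨D, π, hD, fun c => ⟨_, refl_mem_stab, fun d hd => ⟨hd, rfl⟩, 0,
      fun d hd h => absurd h (hne d hd)⟩⟩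
  obtain ⟨x, hxD, hxi⟩ := hne
  obtain ⟨E, ρ, hE, hcard⟩ := exists_isPartite_card hhom hfree hX (hD.mem_of_some x hxD i hxi) i
    (r * (D.filter fun a => π a = some i).card + 1)
  have hmap := fun k => hD.exists_map_part hhom hX hE i k
  choose g hg hgk using hmap
  -- A copy of `D` is attached to `E` along every injection `k` of the `i`-th part of `D` into that
  -- of `E`; the colouring later selects one `k` with monochromatic image.
  obtain ⟨D', π', hD', hED', hπ', hcopy⟩ := hE.amalgam_family hhom hfree hX
    (π := fun _ => π) (W := F ∪ D.filter fun a => π a = some i) Finset.subset_union_left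
    (Finset.union_subset hD.subset (Finset.filter_subset _ _)) (fun _ => hD) hg
    (by
      intro k w hw
      obtain hw | hw := Finset.mem_union.1 hw
      · rw [hg k w hw, hD.none_of_mem w hw, hE.none_of_mem w hw]
        exact ⟨hE.subset hw, rfl⟩
      · rw [hgk k ⟨w, hw⟩, (Finset.mem_filter.1 hw).2]
        exact Finset.mem_filter.1 (k ⟨w, hw⟩).2) Finset.univ
  refine ⟨D', π', hD', fun c => ?_⟩
  obtain ⟨y, k, hy⟩ := exists_embedding_fiber
    (α := {a // a ∈ D.filter fun a => π a = some i})
    (β := {a // a ∈ E.filter fun a => ρ a = some i}) (fun a => c a.1) (by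
      simp only [Fintype.card_coe]; omega)
  obtain ⟨f, hf, hfW, hfD⟩ := hcopy k (Finset.mem_univ _)
  refine ⟨f, hf, hfD, y, fun d hd hdi => ?_⟩
  have hd' : d ∈ D.filter fun a => π a = some i := Finset.mem_filter.2 ⟨hd, hdi⟩
  rw [hfW d (Finset.mem_union_right _ hd'), hgk k ⟨d, hd'⟩]
  exact hy _

/-- The first `N` parts of a partite set can be made monochromatic simultaneously. -/
theorem IsPartite.exists_monochromatic_parts [L.IsRelational] (hhom : L.IsUltrahomogeneous U)
    (hfree : IsFreeAmalgamationAge (L.age U)) (hX : IsOrbitOver L F X)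
    {D : Finset U} {π : U → Option ℕ} (hD : IsPartite L F X D π) (r N : ℕ) [NeZero r] :
    ∃ (D' : Finset U) (π' : U → Option ℕ), IsPartite L F X D' π' ∧
      ∀ c : U → Fin r, ∃ g ∈ stab L (F : Set U), (∀ d ∈ D, g d ∈ D' ∧ π' (g d) = π d) ∧
        ∀ i < N, ∃ y, ∀ d ∈ D, π d = some i → c (g d) = y := by
  induction N with
  | zero => exact ⟨D, π, hD, fun c => ⟨_, refl_mem_stab, fun d hd => ⟨hd, rfl⟩, by simp⟩⟩
  | succ N ih =>
    obtain ⟨D₁, π₁, hD₁, h₁⟩ := ih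
    obtain ⟨D₂, π₂, hD₂, h₂⟩ := hD₁.exists_monochromatic_part hhom hfree hX r N
    refine ⟨D₂, π₂, hD₂, fun c => ?_⟩
    -- The outer map fixes the colour of part `N`. The inner one is chosen for the pulled-back
    -- colouring and respects indices, so it keeps part `N` monochromatic.
    obtain ⟨g₂, hg₂, hgD₂, y, hy⟩ := h₂ c
    obtain ⟨g₁, hg₁, hgD₁, hy₁⟩ := h₁ (c ∘ g₂)
    refine ⟨g₂.comp g₁, stab_comp hg₂ hg₁, fun d hd => ?_, fun i hi => ?_⟩
    · have hd₁ := hgD₁ d hd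
      exact ⟨(hgD₂ _ hd₁.1).1, (hgD₂ _ hd₁.1).2.trans hd₁.2⟩
    · obtain hi | rfl := Nat.lt_succ_iff_lt_or_eq.1 hi
      · exact hy₁ i hi
      · exact ⟨y, fun d hd hdi => hy _ (hgD₁ d hd).1 ((hgD₁ d hd).2.trans hdi)⟩

end Partite

/-! ### Vertex Ramsey properties. -/

section Ramsey

variable {L : FirstOrder.Language.{u, v}} {U : Type w} [L.Structure U] {F : Finset U}

/-- Vertex Ramsey property for a single orbit. -/
theorem exists_monochromatic_copy [L.IsRelational] (hhom : L.IsUltrahomogeneous U)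
    (hfree : IsFreeAmalgamationAge (L.age U)) {X : Set U} (hX : IsOrbitOver L F X)
    (A : Finset U) (r : ℕ) [NeZero r] :
    ∃ C : Finset U, ∀ c : U → Fin r, ∃ g ∈ stab L (F : Set U), (∀ a ∈ A, g a ∈ C) ∧
      ∀ a ∈ A, ∀ b ∈ A, a ∈ X → b ∈ X → c (g a) = c (g b) := by
  classical
  let N := r * (A.filter (· ∈ X)).card + 1
  -- Injectivity of `f` puts at most one point in each part, so partiteness is automatic.
  let π : ({a // a ∈ A.filter (· ∈ X)} ↪ Fin N) → U → Option ℕ := fun f a =>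
    if h : a ∈ A.filter (· ∈ X) then some (f ⟨a, h⟩) else none
  have hsome : ∀ f a i, π f a = some i →
      ∃ h : a ∈ A.filter (· ∈ X), (f ⟨a, h⟩ : ℕ) = i := by
    intro f a i h
    by_cases ha : a ∈ A.filter (· ∈ X)
    · simp only [π, dif_pos ha] at h
      exact ⟨ha, Option.some.inj h⟩
    · simp only [π, dif_neg ha] at h
      exact (Option.some_ne_none _ h.symm).elim
  have hF : ∀ f, ∀ a ∈ F, π f a = none := fun f a ha => dif_neg fun h =>
    hX.notMem a (Finset.mem_filter.1 h).2 ha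
  have hπ : ∀ f, IsPartite L F X (A ∪ F) (π f) := fun f =>
    { subset := Finset.subset_union_right
      none_of_mem := hF f
      mem_of_some := fun a _ i hi => (Finset.mem_filter.1 (hsome f a i hi).1).2
      eq_of_rel := fun n R x _ _ p q i hp hq => by
        obtain ⟨h, hp⟩ := hsome f _ i hp
        obtain ⟨h', hq⟩ := hsome f _ i hq
        exact congrArg Subtype.val (f.injective (Fin.ext (hp.trans hq.symm))) }
  obtain ⟨D, ρ, hD, -, -, hcopy⟩ := (isPartite_base (L := L)).amalgam_family hhom hfree hX
    (D := A ∪ F) (W := F) (g := fun _ => FirstOrder.Language.Equiv.refl L U) (π := π)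
    subset_rfl Finset.subset_union_right
    hπ (fun _ => refl_mem_stab) (fun f w hw => ⟨hw, (hF f w hw).symm⟩) Finset.univ
  obtain ⟨C, _, _, hC⟩ := hD.exists_monochromatic_parts hhom hfree hX r N
  refine ⟨C, fun c => ?_⟩
  obtain ⟨g, hg, hgD, hmono⟩ := hC c
  -- The colouring now depends only on the part. Since `N` exceeds `r` times the number of points to
  -- place, some `f` uses only parts of one colour, and the copy of `A` built for that `f` is the
  -- required one.
  choose χ hχ using fun i : Fin N => hmono i i.2
  obtain ⟨y, f, hf⟩ := exists_embedding_fiber (α := {a // a ∈ A.filter (· ∈ X)}) χ (by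
    simp only [Fintype.card_coe, Fintype.card_fin]; exact Nat.lt_succ_self _)
  obtain ⟨h, hh, -, hhD⟩ := hcopy f (Finset.mem_univ _)
  have hcol : ∀ a ∈ A, a ∈ X → c (g (h a)) = y := by
    intro a ha haX
    have ha' : a ∈ A.filter (· ∈ X) := Finset.mem_filter.2 ⟨ha, haX⟩
    obtain ⟨h₁, h₂⟩ := hhD a (Finset.mem_union_left _ ha)
    rw [hχ (f ⟨a, ha'⟩) _ h₁ (h₂.trans (dif_pos ha')), hf]
  refine ⟨g.comp h, stab_comp hg hh, fun a ha =>
    (hgD _ (hhD a (Finset.mem_union_left _ ha)).1).1, fun a ha b hb haX hbX => ?_⟩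
  exact (hcol a ha haX).trans (hcol b hb hbX).symm

/-- Vertex Ramsey property for finitely many orbits simultaneously. -/
theorem exists_monochromatic_copy_family [L.IsRelational] (hhom : L.IsUltrahomogeneous U)
    (hfree : IsFreeAmalgamationAge (L.age U)) {ι : Type*} {X : ι → Set U}
    (hX : ∀ t, IsOrbitOver L F (X t)) (A : Finset U) (r : ℕ) [NeZero r]
    (s : Finset ι) :
    ∃ C : Finset U, ∀ c : ι → U → Fin r, ∃ g ∈ stab L (F : Set U), (∀ a ∈ A, g a ∈ C) ∧
      ∀ t ∈ s, ∀ a ∈ A, ∀ b ∈ A, a ∈ X t → b ∈ X t → c t (g a) = c t (g b) := by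
  classical
  induction s using Finset.induction_on with
  | empty => exact ⟨A, fun c => ⟨_, refl_mem_stab, fun a ha => ha, by simp⟩⟩
  | insert t s _ ih =>
    obtain ⟨C₁, h₁⟩ := ih
    obtain ⟨C₂, h₂⟩ := exists_monochromatic_copy hhom hfree (hX t) C₁ r
    refine ⟨C₂, fun c => ?_⟩
    obtain ⟨g₂, hg₂, hC₂, hc₂⟩ := h₂ (c t)
    -- Since `g₁` preserves each orbit, the homogeneity of `c t` on `g₂[C₁]` survives restriction to
    -- the inner copy.
    obtain ⟨g₁, hg₁, hC₁, hc₁⟩ := h₁ fun t => c t ∘ g₂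
    refine ⟨g₂.comp g₁, stab_comp hg₂ hg₁, fun a ha => hC₂ _ (hC₁ a ha), ?_⟩
    intro j hj a ha b hb haX hbX
    obtain rfl | hj := Finset.mem_insert.1 hj
    · exact hc₂ _ (hC₁ a ha) _ (hC₁ b hb) ((hX j).map_mem _ hg₁ _ haX)
        ((hX j).map_mem _ hg₁ _ hbX)
    · exact hc₁ j hj a ha b hb haX hbX

end Ramsey

/-! ### From the Ramsey property to age indivisibility of bundles and types. -/

section Bundles

variable {L : FirstOrder.Language.{u, v}} {U : Type w} [L.Structure U]

theorem UType.isOrbitOver (T : UType L U) : IsOrbitOver L T.sockel T.typeset := by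
  induction T using Quotient.inductionOn with
  | h p =>
    refine ⟨fun x hx => hx.1, ?_, ?_⟩
    · rintro g hg x ⟨hx, k, hk, rfl⟩
      refine ⟨fun h => hx ?_, g.comp k, stab_comp hg hk, rfl⟩
      have := g.injective (hg _ h)
      rwa [this] at h
    · rintro x ⟨hx, k, hk, rfl⟩ y ⟨hy, l, hl, rfl⟩
      refine ⟨l.comp k.symm, stab_comp hl fun a ha => ?_, ?_⟩
      · rw [← k.injective.eq_iff, k.apply_symm_apply, hk a ha]
      · simp [FirstOrder.Language.Equiv.comp_apply]

theorem UType.typeset_nonempty (T : UType L U) : T.typeset.Nonempty := by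
  induction T using Quotient.inductionOn with
  | h p => exact ⟨p.pt, p.pt_notMem, _, refl_mem_stab, rfl⟩

theorem bundleSockel_eq {𝓑 : Set (UType L U)} (h𝓑 : IsBundle 𝓑) {T : UType L U} (hT : T ∈ 𝓑) :
    bundleSockel 𝓑 = (T.sockel : Set U) := by
  ext a
  simp only [bundleSockel, Set.mem_iUnion]
  exact ⟨fun ⟨S, hS, ha⟩ => h𝓑 S hS T hT ▸ ha, fun ha => ⟨T, hT, ha⟩⟩

/-- This covers the empty bundle, which has no type to supply a sockel; there `F = ∅`. -/
theorem exists_bundleSockel_eq {𝓑 : Set (UType L U)} (h𝓑 : IsBundle 𝓑) :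
    ∃ F : Finset U, bundleSockel 𝓑 = (F : Set U) ∧ ∀ T ∈ 𝓑, T.sockel = F := by
  by_cases h : ∃ T, T ∈ 𝓑
  · obtain ⟨T, hT⟩ := h
    exact ⟨T.sockel, bundleSockel_eq h𝓑 hT, fun S hS => h𝓑 S hS T hT⟩
  · push Not at h
    refine ⟨∅, ?_, fun T hT => absurd hT (h T)⟩
    simp [bundleSockel, h]

/-- The identity is a witness. Hence age completeness of `S` means that every finite subset of the
typeset union moves into `S`. -/
theorem mem_bundleAge_bundleTypeset {𝓑 : Set (UType L U)} {A : Finset U} :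
    A ∈ bundleAge 𝓑 (bundleTypeset 𝓑) ↔ (A : Set U) ⊆ bundleTypeset 𝓑 :=
  ⟨fun h => h.1, fun h => ⟨h, _, refl_mem_stab, by rintro _ ⟨a, ha, rfl⟩; exact h ha⟩⟩

/-- Every colouring of an age complete set has an age complete selection of parts. -/
theorem exists_isAgeComplete_select [L.IsRelational] (hhom : L.IsUltrahomogeneous U)
    (hfree : IsFreeAmalgamationAge (L.age U)) {𝓑 : Set (UType L U)} (h𝓑 : IsBundle 𝓑)
    (hfin : 𝓑.Finite) {S : Set U} (hS : IsAgeComplete 𝓑 S) (P : Colouring 𝓑 S) :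
    ∃ ε : P.Choice, IsAgeComplete 𝓑 (P.select ε) := by
  classical
  obtain ⟨F, hF, hFT⟩ := exists_bundleSockel_eq h𝓑
  have horb : ∀ T : 𝓑, IsOrbitOver L F T.1.typeset := fun T => hFT T.1 T.2 ▸ T.1.isOrbitOver
  have hsub : ∀ T : 𝓑, T.1.typeset ⊆ bundleTypeset 𝓑 := fun T =>
    Set.subset_biUnion_of_mem (u := fun T : UType L U => T.typeset) T.2
  have := hfin.fintype
  have : Finite P.Choice := inferInstanceAs (Finite ((T : 𝓑) → Fin (P.numColours T)))
  have := Fintype.ofFinite P.Choice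
  have hS' : ∀ A : Finset U, (A : Set U) ⊆ bundleTypeset 𝓑 →
      ∃ g ∈ stab L (F : Set U), ∀ a ∈ A, g a ∈ S := by
    intro A hA
    rw [← mem_bundleAge_bundleTypeset, ← hS] at hA
    obtain ⟨-, g, hg, hgA⟩ := hA
    exact ⟨g, hF ▸ hg, fun a ha => hgA ⟨a, ha, rfl⟩⟩
  have hcov : ∀ (T : 𝓑) (a : U), a ∈ S → a ∈ T.1.typeset → ∃ i, a ∈ P.part T i := by
    intro T a ha haT
    have : a ∈ ⋃ i, P.part T i := P.cover T ▸ ⟨ha, haT⟩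
    exact Set.mem_iUnion.1 this
  by_contra! hcon
  have hbad : ∀ ε : P.Choice, ∃ A : Finset U, (A : Set U) ⊆ bundleTypeset 𝓑 ∧
      ¬ ∃ g ∈ stab L (F : Set U), ∀ a ∈ A, g a ∈ P.select ε := by
    intro ε
    by_contra! h
    refine hcon ε (Set.ext fun A => ⟨fun hA => mem_bundleAge_bundleTypeset.2 hA.1, fun hA => ?_⟩)
    obtain ⟨g, hg, hgA⟩ := h A hA.1
    exact ⟨hA.1, g, hF ▸ hg, by rintro _ ⟨a, ha, rfl⟩; exact hgA a ha⟩
  choose A hAsub hA using hbad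
  -- There are finitely many choices, so a single finite set defeats all of them. The `+ 1` in `r`
  -- keeps the palette nonempty.
  let A' : Finset U := Finset.univ.biUnion A
  let r := (Finset.univ.sup P.numColours) + 1
  obtain ⟨C, hC⟩ := exists_monochromatic_copy_family hhom hfree horb A' r Finset.univ
  obtain ⟨h, hh, hhC⟩ := hS' (C.filter (· ∈ bundleTypeset 𝓑)) fun a ha =>
    (Finset.mem_filter.1 (Finset.mem_coe.1 ha)).2
  -- The colouring of `S` is pulled back along `h`. The default `0` is harmless: by `hpart`, the
  -- relevant points do land in a part.
  let c : 𝓑 → U → Fin r := fun T a =>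
    if H : ∃ i, h a ∈ P.part T i then
      ⟨H.choose, lt_of_lt_of_le H.choose.2
        ((Finset.le_sup (f := P.numColours) (Finset.mem_univ T)).trans (Nat.le_succ _))⟩
    else 0
  have hc : ∀ (T : 𝓑) (a b : U), (∃ i, h b ∈ P.part T i) → ∀ (H : ∃ i, h a ∈ P.part T i),
      c T a = c T b → h b ∈ P.part T H.choose := by
    intro T a b H' H hab
    simp only [c, dif_pos H, dif_pos H'] at hab
    have : H.choose = H'.choose := Fin.ext (Fin.mk.inj hab)
    rw [this]
    exact H'.choose_spec
  obtain ⟨g, hg, hgA, hmono⟩ := hC c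
  have hpart : ∀ T : 𝓑, ∀ a ∈ A', a ∈ T.1.typeset → ∃ i, h (g a) ∈ P.part T i := by
    intro T a ha haT
    have hga := (horb T).map_mem g hg a haT
    exact hcov T _ (hhC _ (Finset.mem_filter.2 ⟨hgA a ha, hsub T hga⟩))
      ((horb T).map_mem h hh _ hga)
  have hchoice : ∀ T : 𝓑, ∃ i, ∀ a ∈ A', a ∈ T.1.typeset → h (g a) ∈ P.part T i := by
    intro T
    by_cases hne : ∃ a ∈ A', a ∈ T.1.typeset
    · obtain ⟨a, ha, haT⟩ := hne
      exact ⟨(hpart T a ha haT).choose, fun b hb hbT => hc T _ _ (hpart T b hb hbT) _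
        (hmono T (Finset.mem_univ _) a ha b hb haT hbT)⟩
    · push Not at hne
      -- No point of `A'` constrains the index, but one must exist: age completeness moves a point
      -- of the typeset into `S`, hence into some part.
      obtain ⟨x, hx⟩ := T.1.typeset_nonempty
      obtain ⟨k, hk, hkx⟩ := hS' {x} (by simpa using hsub T hx)
      obtain ⟨i, -⟩ := hcov T (k x) (hkx x (Finset.mem_singleton_self x))
        ((horb T).map_mem k hk x hx)
      exact ⟨i, fun a ha haT => absurd haT (hne a ha)⟩
  choose ε hε using hchoice
  refine hA ε ⟨h.comp g, stab_comp hh hg, fun a ha => ?_⟩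
  obtain ⟨T, hT, haT⟩ := Set.mem_iUnion₂.1 (hAsub ε ha)
  exact Set.mem_iUnion.2 ⟨⟨T, hT⟩, hε ⟨T, hT⟩ a
    (Finset.mem_biUnion.2 ⟨ε, Finset.mem_univ _, ha⟩) haT⟩

theorem Colouring.select_subset {𝓑 : Set (UType L U)} {S : Set U} (P : Colouring 𝓑 S)
    (ε : P.Choice) : P.select ε ⊆ S := by
  intro a ha
  obtain ⟨T, ha⟩ := Set.mem_iUnion.1 ha
  have : a ∈ S ∩ T.1.typeset := P.cover T ▸ Set.mem_iUnion.2 ⟨_, ha⟩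
  exact this.1

/-- A partition of the typeset is a colouring of the one-type bundle with two colours, and a choice
is then one of the two parts. -/
theorem UType.isAgeIndivisible_of_bundle (T : UType L U)
    (h : IsBundleAgeIndivisible {T} (bundleTypeset ({T} : Set (UType L U)))) :
    T.IsAgeIndivisible := by
  intro S hdisj hcov
  have hset : bundleTypeset ({T} : Set (UType L U)) = T.typeset := by simp [bundleTypeset]
  have hsock : bundleSockel ({T} : Set (UType L U)) = T.sockel := by simp [bundleSockel]
  let P : Colouring ({T} : Set (UType L U)) (bundleTypeset ({T} : Set (UType L U))) :=
    { numColours := fun _ => 2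
      part := fun _ i => S i
      disjoint := by
        rintro ⟨_, rfl⟩ ⟨_, rfl⟩ i i' hne
        fin_cases i <;> fin_cases i' <;> first | exact absurd rfl hne | exact hdisj | exact hdisj.symm
      cover := by
        rintro ⟨_, rfl⟩
        rw [hset, Set.inter_self, ← hcov]
        ext a
        simp [Fin.exists_fin_two] }
  obtain ⟨ε, hε⟩ := h P
  refine ⟨ε ⟨T, rfl⟩, fun A hA => ?_⟩
  have hmem : A ∈ bundleAge {T} (P.select ε) := by
    rw [hε, mem_bundleAge_bundleTypeset, hset]
    exact hA
  obtain ⟨-, f, hf, hfA⟩ := hmem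
  refine ⟨f, hsock ▸ hf, fun a ha => ?_⟩
  obtain ⟨⟨_, rfl⟩, ha⟩ := Set.mem_iUnion.1 (hfA ha)
  exact ha

end Bundles

end FreeAmalg

theorem theorem9p3 {L : FirstOrder.Language.{u, v}} [L.IsRelational] [IsEmpty (L.Relations 0)]
    {U : Type w} [L.Structure U] [Countable U]
    (hinj : FreeAmalg.HasInjectiveRelations L U)
    (hhom : L.IsUltrahomogeneous U)
    (hfree : FreeAmalg.IsFreeAmalgamationAge (L.age U)) :
    (∀ 𝓑 : Set (FreeAmalg.UType L U), FreeAmalg.IsBundle 𝓑 → 𝓑.Finite →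
      (∀ S ⊆ FreeAmalg.bundleTypeset 𝓑, FreeAmalg.IsAgeComplete 𝓑 S →
        ∀ (m : ℕ) (P : FreeAmalg.Colouring 𝓑 S), P.IsMColouring m →
          ∃ ε : P.Choice, FreeAmalg.bundleAge 𝓑 (P.select ε ∩ S) =
            FreeAmalg.bundleAge 𝓑 (FreeAmalg.bundleTypeset 𝓑)) ∧
      (∀ S ⊆ FreeAmalg.bundleTypeset 𝓑, FreeAmalg.IsAgeComplete 𝓑 S →
        FreeAmalg.IsBundleAgeIndivisible 𝓑 S) ∧
      FreeAmalg.IsBundleAgeIndivisible 𝓑 (FreeAmalg.bundleTypeset 𝓑)) ∧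
    (∀ T : FreeAmalg.UType L U, T.IsAgeIndivisible) := by
  -- All four clauses come from one selection theorem: selected parts lie in `S`, the whole typeset
  -- union is trivially age complete, and a single type is a singleton bundle.
  have main : ∀ 𝓑 : Set (FreeAmalg.UType L U), FreeAmalg.IsBundle 𝓑 → 𝓑.Finite →
      ∀ S, FreeAmalg.IsAgeComplete 𝓑 S → FreeAmalg.IsBundleAgeIndivisible 𝓑 S := by
    intro 𝓑 h𝓑 hfin S hS P
    obtain ⟨ε, hε⟩ := FreeAmalg.exists_isAgeComplete_select hhom hfree h𝓑 hfin hS P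
    exact ⟨ε, hε.trans hS.symm⟩
  refine ⟨fun 𝓑 h𝓑 hfin => ⟨fun S _ hS m P _ => ?_, fun S _ hS => main 𝓑 h𝓑 hfin S hS,
    main 𝓑 h𝓑 hfin _ rfl⟩, fun T => T.isAgeIndivisible_of_bundle (main _ ?_ ?_ _ rfl)⟩
  · obtain ⟨ε, hε⟩ := FreeAmalg.exists_isAgeComplete_select hhom hfree h𝓑 hfin hS P
    exact ⟨ε, by rw [Set.inter_eq_left.2 (P.select_subset ε)]; exact hε⟩
  · rintro S rfl T rfl
    rfl
  · exact Set.finite_singleton T
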